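/- A cograph is a graph with no induced path on four vertices. For a finite simple graph $G$ with $n$ vertices and an integer $k$, the $k$-recolouring graph $R_k(G)$ has as vertices the proper $k$-colourings $V(G)\to\{1,\dots,k\}$ of $G$, two colourings being adjacent if they differ on exactly one vertex; $G$ is $k$-mixing if $R_k(G)$ is connected, and the $k$-recolouring diameter of a $k$-mixing graph $G$ is the diameter of $R_k(G)$. Let $\chi(G)$ denote the chromatic number of $G$. There is an absolute constant $C$ such that for every finite cograph $G$ on $n$ vertices and every integer $k \geq \chi(G)+1$, the graph $G$ is $k$-mixing and its $k$-recolouring diameter is at most $C\cdot\chi(G)\cdot n$. -/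

import Mathlib

namespace SimpleGraph

/-- A cograph is a graph with no induced path on four vertices. -/
def IsCograph {V : Type*} (G : SimpleGraph V) : Prop :=
  ¬ (pathGraph 4).IsIndContained G

/-- The `k`-recolouring graph of `G`: its vertices are the proper `k`-colourings of `G`, and two
colourings are adjacent iff they differ on exactly one vertex. -/
def recoloringGraph {V : Type*} (G : SimpleGraph V) (k : ℕ) : SimpleGraph (G.Coloring (Fin k)) where
  Adj α β := ∃! v, α v ≠ β v
  symm := ⟨fun _ _ ⟨v, hv, huniq⟩ => ⟨v, hv.symm, fun w hw => huniq w hw.symm⟩⟩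
  loopless := ⟨fun _ ⟨_, hv, _⟩ => hv rfl⟩

/-- `G` is `k`-mixing if its `k`-recolouring graph is connected. -/
def IsMixing {V : Type*} (G : SimpleGraph V) (k : ℕ) : Prop :=
  (G.recoloringGraph k).Connected

/-- The `k`-recolouring diameter of `G` is the diameter of its `k`-recolouring graph
(infinite if two colourings are not joined by any sequence). -/
noncomputable def recoloringDiam {V : Type*} (G : SimpleGraph V) (k : ℕ) : ℕ∞ :=
  (G.recoloringGraph k).ediam

end SimpleGraph

/-! A cograph on at least two vertices, or its complement, is disconnected
(`PathFourFree.splitsOn`), so cographs arise from single vertices by disjoint unions and joins.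
Along this decomposition one builds a colouring `γ` with `m` colours and a clique of size `m`, which
forces `m ≤ χ`. By induction (`IsHub`), with any palette of more than `m` colours, every colouring
reaches every injective renaming of `γ` in `2 * m * n` steps; two colourings then meet halfway.
Palette and renaming are arbitrary because in a join each side must avoid the colours of the other.

Unions are immediate. In a join some side has a spare colour among those unused by the other.
Recolouring it to its hub leaves the other side a spare colour too; a final renaming of classes
(`exists_recolorsTo_rename`) moves each vertex at most twice. -/

namespace SimpleGraph

variable {V K : Type*} {G : SimpleGraph V}

/-! ### Splitting a graph without induced four-vertex paths -/

/-- No four vertices induce a path. -/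
def PathFourFree (G : SimpleGraph V) : Prop :=
  ∀ a b c d, G.Adj a b → G.Adj b c → G.Adj c d → a ≠ c → b ≠ d →
    ¬ G.Adj a c → ¬ G.Adj b d → ¬ G.Adj a d → False

theorem IsCograph.pathFourFree (h : G.IsCograph) : G.PathFourFree := by
  intro a b c d hab hbc hcd nac nbd hac hbd had
  have nab := hab.ne
  have nbc := hbc.ne
  have ncd := hcd.ne
  have nad : a ≠ d := by rintro rfl; exact hac hcd.symm
  have hba := hab.symm
  have hcb := hbc.symm
  have hdc := hcd.symm
  have hca : ¬ G.Adj c a := fun h => hac h.symm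
  have hdb : ¬ G.Adj d b := fun h => hbd h.symm
  have hda : ¬ G.Adj d a := fun h => had h.symm
  refine h ⟨⟨⟨![a, b, c, d], ?_⟩, ?_⟩⟩
  · intro i j
    fin_cases i <;> fin_cases j <;> simp_all [eq_comm]
  · intro i j
    change G.Adj (![a, b, c, d] i) (![a, b, c, d] j) ↔ _
    fin_cases i <;> fin_cases j <;> simp_all [pathGraph_adj]

/-- The four-vertex path is self-complementary: a path `a b c d` in `Gᶜ` is the path `c a d b` in
`G`. -/
theorem PathFourFree.compl (h : G.PathFourFree) : Gᶜ.PathFourFree := by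
  intro a b c d hab hbc hcd nac nbd hac hbd had
  simp only [compl_adj, not_and, not_not] at *
  have nad : a ≠ d := by
    rintro rfl
    exact hcd.2 (hac nac).symm
  exact h c a d b (hac nac).symm (had nad) (hbd nbd).symm hcd.1 hab.1
    (fun h => hcd.2 h) (fun h => hab.2 h) (fun h => hbc.2 h.symm)

/-- `U` is partitioned into two nonempty parts without edges between them. -/
def SplitsOn [DecidableEq V] (G : SimpleGraph V) (U : Finset V) : Prop :=
  ∃ A B : Finset V, A.Nonempty ∧ B.Nonempty ∧ Disjoint A B ∧ A ∪ B = U ∧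
    ∀ a ∈ A, ∀ b ∈ B, ¬ G.Adj a b

/-- If neither splits, `v` has a non-neighbour in one part `A`, a neighbour `z` in the other, and an
edge `p q` of `A` with only `p` adjacent to `v`; then `z v p q` is an induced path. -/
theorem SplitsOn.insert_vertex [DecidableEq V] (h : G.PathFourFree) {U : Finset V} {v : V}
    (hv : v ∉ U) (hU : G.SplitsOn U) : G.SplitsOn (insert v U) ∨ Gᶜ.SplitsOn (insert v U) := by
  classical
  by_contra! hcon
  obtain ⟨hG, hGc⟩ := hcon
  obtain ⟨y, hyU, hvy⟩ : ∃ y ∈ U, ¬ G.Adj v y := by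
    by_contra! hall
    refine hGc ⟨{v}, U, by simp, ?_, by simpa using hv, by rw [Finset.insert_eq], ?_⟩
    · obtain ⟨A, B, hA, -, -, rfl, -⟩ := hU
      exact hA.mono Finset.subset_union_left
    · intro a ha b hb
      rw [Finset.mem_singleton] at ha
      subst ha
      simp [hall b hb]
  obtain ⟨A, B, hyA, hB, hdisj, hAB, hno⟩ : ∃ A B : Finset V, y ∈ A ∧ B.Nonempty ∧ Disjoint A B ∧
      A ∪ B = U ∧ ∀ a ∈ A, ∀ b ∈ B, ¬ G.Adj a b := by
    obtain ⟨A, B, hA, hB, hdisj, hAB, hno⟩ := hU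
    rw [← hAB, Finset.mem_union] at hyU
    rcases hyU with hy | hy
    · exact ⟨A, B, hy, hB, hdisj, hAB, hno⟩
    · exact ⟨B, A, hy, hA, hdisj.symm, by rw [Finset.union_comm, hAB],
        fun b hb a ha hadj => hno a ha b hb hadj.symm⟩
  have hvA : v ∉ A := fun h => hv (hAB ▸ Finset.mem_union_left _ h)
  have hvB : v ∉ B := fun h => hv (hAB ▸ Finset.mem_union_right _ h)
  have hAB' := Finset.disjoint_left.1 hdisj
  obtain ⟨z, hzB, hvz⟩ : ∃ z ∈ B, G.Adj v z := by
    by_contra! hall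
    refine hG ⟨insert v A, B, by simp, hB, ?_, by rw [Finset.insert_union, hAB], ?_⟩
    · exact Finset.disjoint_insert_left.2 ⟨hvB, hdisj⟩
    · intro a ha b hb
      rcases Finset.mem_insert.1 ha with rfl | ha
      · exact hall b hb
      · exact hno a ha b hb
  obtain ⟨p, hp, hvp, q, hq, hvq, hpq⟩ :
      ∃ p ∈ A, G.Adj v p ∧ ∃ q ∈ A, ¬ G.Adj v q ∧ G.Adj p q := by
    by_contra! hall
    refine hG ⟨A.filter fun a => ¬ G.Adj v a, insert v (A.filter (fun a => G.Adj v a) ∪ B),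
      ⟨y, by simp [hyA, hvy]⟩, by simp, ?_, ?_, ?_⟩
    · rw [Finset.disjoint_left]
      intro a ha hb
      simp only [Finset.mem_filter, Finset.mem_insert, Finset.mem_union] at ha hb
      rcases hb with rfl | hb | hb
      · exact hvA ha.1
      · exact ha.2 hb.2
      · exact hAB' ha.1 hb
    · ext a
      simp only [← hAB, Finset.mem_filter, Finset.mem_insert, Finset.mem_union]
      tauto
    · intro a ha b hb
      simp only [Finset.mem_filter, Finset.mem_insert, Finset.mem_union] at ha hb
      rcases hb with rfl | hb | hb
      · exact fun h => ha.2 h.symm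
      · exact fun h => hall b hb.1 hb.2 a ha.1 ha.2 h.symm
      · exact hno a ha.1 b hb
  refine h z v p q hvz.symm hvp hpq ?_ ?_ ?_ hvq ?_
  · rintro rfl; exact hAB' hp hzB
  · rintro rfl; exact hvA hq
  · exact fun h => hno p hp z hzB h.symm
  · exact fun h => hno q hq z hzB h.symm

/-- A set of at least two vertices of a cograph is disconnected in the graph or its complement. -/
theorem PathFourFree.splitsOn [DecidableEq V] (h : G.PathFourFree) (U : Finset V)
    (hU : 2 ≤ U.card) : G.SplitsOn U ∨ Gᶜ.SplitsOn U := by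
  induction U using Finset.induction_on with
  | empty => simp at hU
  | insert v U hv ih =>
    rw [Finset.card_insert_of_notMem hv] at hU
    rcases Nat.lt_or_ge U.card 2 with hlt | hge
    · obtain ⟨w, rfl⟩ := Finset.card_eq_one.1 (by omega : U.card = 1)
      have hvw : v ≠ w := by simpa using hv
      by_cases hadj : G.Adj v w
      · exact Or.inr ⟨{v}, {w}, by simp, by simp, by simpa using hvw,
          by rw [Finset.insert_eq], by simp [hadj]⟩
      · exact Or.inl ⟨{v}, {w}, by simp, by simp, by simpa using hvw,
          by rw [Finset.insert_eq], by simp [hadj]⟩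
    · rcases ih hge with hs | hs
      · exact hs.insert_vertex h hv
      · simpa using (hs.insert_vertex h.compl hv).symm

/-! ### Recolouring sequences on a set of vertices -/

/-- `g` arises from `f` by at most `n` recolourings of vertices of `U` with colours in `S`, each
keeping the colouring proper on `U`. -/
inductive RecolorsTo [DecidableEq V] (G : SimpleGraph V) (U : Finset V) (S : Finset K) :
    ℕ → (V → K) → (V → K) → Prop
  | refl (f : V → K) (n : ℕ) : RecolorsTo G U S n f f
  | step {n : ℕ} {f g : V → K} {v : V} {c : K} (h : RecolorsTo G U S n f g) (hv : v ∈ U)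
      (hc : c ∈ S) (hfree : ∀ w ∈ U, G.Adj v w → g w ≠ c) :
      RecolorsTo G U S (n + 1) f (Function.update g v c)

namespace RecolorsTo

variable [DecidableEq V] {U U' : Finset V} {S S' : Finset K} {m n : ℕ} {f g h : V → K}

theorem mono (hfg : G.RecolorsTo U S m f g) (hmn : m ≤ n) : G.RecolorsTo U S n f g := by
  induction hfg generalizing n with
  | refl f m => exact refl f n
  | step h hv hc hfree ih =>
    obtain ⟨n, rfl⟩ := Nat.exists_eq_add_of_le' (show 1 ≤ n by omega)
    exact (ih (by omega)).step hv hc hfree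

theorem trans (hfg : G.RecolorsTo U S m f g) (hgh : G.RecolorsTo U S n g h) :
    G.RecolorsTo U S (m + n) f h := by
  induction hgh with
  | refl g n => exact hfg.mono (by omega)
  | step h hv hc hfree ih => exact (ih hfg).step hv hc hfree

theorem eq_of_notMem (hfg : G.RecolorsTo U S n f g) {v : V} (hv : v ∉ U) : g v = f v := by
  induction hfg with
  | refl => rfl
  | step h hw hc hfree ih =>
    rw [Function.update_of_ne (by rintro rfl; exact hv hw), ih]

/-- Vertices outside `U` keep their initial colours, so a palette avoiding the colours of outside
neighbours creates no conflict. -/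
theorem lift (hfg : G.RecolorsTo U S n f g) (hU : U ⊆ U') (hS : S ⊆ S')
    (hout : ∀ v ∈ U, ∀ w ∈ U', w ∉ U → G.Adj v w → f w ∉ S) : G.RecolorsTo U' S' n f g := by
  induction hfg with
  | refl => exact refl _ _
  | step h hv hc hfree ih =>
    refine (ih hout).step (hU hv) (hS hc) fun w hw hadj heq => ?_
    by_cases hwU : w ∈ U
    · exact hfree w hwU hadj heq
    · rw [h.eq_of_notMem hwU] at heq
      exact hout _ hv w hw hwU hadj (heq ▸ hc)

/-- Recolour an independent set `I` with a colour that no neighbour of `I` has. -/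
theorem recolorClass {I : Finset V} {s : K} (hI : I ⊆ U) (hs : s ∈ S)
    (hind : ∀ v ∈ I, ∀ w ∈ I, ¬ G.Adj v w)
    (hfree : ∀ v ∈ I, ∀ w ∈ U, w ∉ I → G.Adj v w → f w ≠ s) :
    G.RecolorsTo U S I.card f (fun v => if v ∈ I then s else f v) := by
  suffices H : ∀ J ⊆ I, G.RecolorsTo U S J.card f (fun v => if v ∈ J then s else f v) from
    H I subset_rfl
  intro J
  induction J using Finset.induction_on with
  | empty => intro _; simpa using refl f 0
  | insert v J hv ih =>
    intro hJ
    rw [Finset.insert_subset_iff] at hJ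
    have hstep := (ih hJ.2).step (v := v) (hI hJ.1) hs (fun w hw hadj => by
      have hwI : w ∉ I := fun hwI => hind v hJ.1 w hwI hadj
      rw [if_neg fun hwJ => hwI (hJ.2 hwJ)]
      exact hfree v hJ.1 w hw hwI hadj)
    rw [Finset.card_insert_of_notMem hv]
    convert hstep using 1
    ext w
    by_cases hwv : w = v
    · subst hwv; simp
    · simp [hwv]

end RecolorsTo

/-! ### Renaming the colour classes -/

/-- The number of times the class coloured `c` must move to get the colour `t`, one of the colours
in `T`. -/
def moveCost [DecidableEq K] (T : Finset K) (t c : K) : ℕ :=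
  if c = t then 0 else if c ∈ T then 2 else 1

section Rename

variable {U : Finset V} {S : Finset K} {m : ℕ} {γ : V → ℕ}

theorem recolorsTo_update_class [DecidableEq V] (hγ : ∀ v ∈ U, γ v < m)
    (hproper : ∀ v ∈ U, ∀ w ∈ U, G.Adj v w → γ v ≠ γ w) {ρ : ℕ → K} {f : V → K}
    (hf : ∀ v ∈ U, f v = ρ (γ v)) {i : ℕ} {s : K} (hs : s ∈ S) (hsρ : ∀ j < m, ρ j ≠ s) :
    ∃ g, G.RecolorsTo U S {v ∈ U | γ v = i}.card f g ∧
      ∀ v ∈ U, g v = Function.update ρ i s (γ v) := by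
  refine ⟨_, RecolorsTo.recolorClass (Finset.filter_subset _ _) hs ?_ ?_, ?_⟩
  · intro v hv w hw hadj
    rw [Finset.mem_filter] at hv hw
    exact hproper v hv.1 w hw.1 hadj (hv.2.trans hw.2.symm)
  · intro v _ w hw _ _
    rw [hf w hw]
    exact hsρ _ (hγ w hw)
  · intro v hv
    by_cases hvi : γ v = i
    · simp [hv, hvi]
    · simp [hvi, hf v hv]

theorem moveCost_le_two [DecidableEq K] (T : Finset K) (t c : K) : moveCost T t c ≤ 2 := by
  unfold moveCost; split_ifs <;> omega

/-- The drop in total cost, weighted by class sizes, pays for moving the whole class. -/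
theorem sum_moveCost_update [DecidableEq K] {T : Finset K} {π ρ : ℕ → K} {i : ℕ} {s : K}
    (hlt : moveCost T (π i) s < moveCost T (π i) (ρ i)) :
    {v ∈ U | γ v = i}.card + ∑ v ∈ U, moveCost T (π (γ v)) (Function.update ρ i s (γ v)) ≤
      ∑ v ∈ U, moveCost T (π (γ v)) (ρ (γ v)) := by
  rw [Finset.card_filter, ← Finset.sum_add_distrib]
  refine Finset.sum_le_sum fun v _ => ?_
  by_cases hvi : γ v = i
  · subst hvi; simp; omega
  · simp [hvi]

/-- With one spare colour, the colour classes can be renamed arbitrarily. -/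
theorem exists_recolorsTo_rename [DecidableEq V] [DecidableEq K] (hS : m < S.card)
    (hγ : ∀ v ∈ U, γ v < m)
    (hproper : ∀ v ∈ U, ∀ w ∈ U, G.Adj v w → γ v ≠ γ w) {π : ℕ → K}
    (hπ : Set.InjOn π (Set.Iio m)) (hπS : ∀ i < m, π i ∈ S) (ρ : ℕ → K)
    (hρ : Set.InjOn ρ (Set.Iio m)) (f : V → K) (hf : ∀ v ∈ U, f v = ρ (γ v)) :
    ∃ g, G.RecolorsTo U S
      (∑ v ∈ U, moveCost ((Finset.range m).image π) (π (γ v)) (ρ (γ v))) f g ∧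
        ∀ v ∈ U, g v = π (γ v) := by
  set T := (Finset.range m).image π with hT
  -- The unweighted cost is the induction measure: moving an empty class does not lower the weighted
  -- one.
  induction hN : ∑ i ∈ Finset.range m, moveCost T (π i) (ρ i) using Nat.strong_induction_on
    generalizing ρ f with
  | _ N ih =>
  have key : ∀ i < m, ∀ s ∈ S, (∀ j < m, ρ j ≠ s) →
      moveCost T (π i) s < moveCost T (π i) (ρ i) →
      ∃ g, G.RecolorsTo U S (∑ v ∈ U, moveCost T (π (γ v)) (ρ (γ v))) f g ∧
        ∀ v ∈ U, g v = π (γ v) := by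
    intro i hi s hs hsρ hlt
    obtain ⟨f', hff', hf'⟩ := recolorsTo_update_class (G := G) hγ hproper hf (i := i) hs hsρ
    have hinj : Set.InjOn (Function.update ρ i s) (Set.Iio m) := by
      intro a ha b hb hab
      by_cases hai : a = i <;> by_cases hbi : b = i
      · rw [hai, hbi]
      · subst hai
        rw [Function.update_self, Function.update_of_ne hbi] at hab
        exact absurd hab.symm (hsρ b hb)
      · subst hbi
        rw [Function.update_self, Function.update_of_ne hai] at hab
        exact absurd hab (hsρ a ha)
      · rw [Function.update_of_ne hai, Function.update_of_ne hbi] at hab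
        exact hρ ha hb hab
    have hdec : ∑ j ∈ Finset.range m, moveCost T (π j) (Function.update ρ i s j) < N := by
      rw [← hN]
      refine Finset.sum_lt_sum (fun j _ => ?_) ⟨i, Finset.mem_range.2 hi, by simpa using hlt⟩
      by_cases hji : j = i
      · subst hji; simpa using hlt.le
      · simp [hji]
    obtain ⟨g, hg, hgπ⟩ := ih _ hdec _ hinj f' hf' rfl
    exact ⟨g, (hff'.trans hg).mono (sum_moveCost_update hlt), hgπ⟩
  by_cases hdone : ∀ i < m, ρ i = π i
  · exact ⟨f, RecolorsTo.refl _ _, fun v hv => (hf v hv).trans (hdone _ (hγ v hv))⟩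
  push Not at hdone
  obtain ⟨i, hi, hne⟩ := hdone
  -- If some target colour is unused, its class moves there directly. Otherwise `ρ` uses exactly the
  -- colours of `T`, and a misplaced class steps aside to a colour outside `T`, its cost falling
  -- from 2 to 1.
  by_cases hfree : ∃ j < m, ∀ l < m, ρ l ≠ π j
  · obtain ⟨j, hj, hj'⟩ := hfree
    refine key j hj (π j) (hπS j hj) hj' ?_
    have := hj' j hj
    unfold moveCost
    rw [if_pos rfl, if_neg this]
    split_ifs <;> omega
  · push Not at hfree
    have hsub : T ⊆ (Finset.range m).image ρ := by
      intro c hc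
      obtain ⟨j, hj, rfl⟩ := Finset.mem_image.1 hc
      obtain ⟨l, hl, hlj⟩ := hfree j (Finset.mem_range.1 hj)
      exact Finset.mem_image.2 ⟨l, Finset.mem_range.2 hl, hlj⟩
    have hTcard : T.card = m := by
      rw [hT, Finset.card_image_of_injOn (by simpa using hπ), Finset.card_range]
    have hTeq : T = (Finset.range m).image ρ :=
      Finset.eq_of_subset_of_card_le hsub
        (by rw [hTcard]; exact Finset.card_image_le.trans (by simp))
    obtain ⟨s, hs, hsT⟩ : ∃ s ∈ S, s ∉ T := by
      by_contra! hall
      have := Finset.card_le_card (show S ⊆ T from hall)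
      omega
    refine key i hi s hs (fun j hj hjs => hsT ?_) ?_
    · rw [hTeq, ← hjs]
      exact Finset.mem_image_of_mem _ (Finset.mem_range.2 hj)
    · have hρT : ρ i ∈ T := by
        rw [hTeq]; exact Finset.mem_image_of_mem _ (Finset.mem_range.2 hi)
      unfold moveCost
      rw [if_neg hne, if_pos hρT, if_neg hsT]
      split_ifs <;> omega

theorem exists_recolorsTo_rename_le [DecidableEq V] [DecidableEq K] (hS : m < S.card)
    (hγ : ∀ v ∈ U, γ v < m)
    (hproper : ∀ v ∈ U, ∀ w ∈ U, G.Adj v w → γ v ≠ γ w) {π : ℕ → K}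
    (hπ : Set.InjOn π (Set.Iio m)) (hπS : ∀ i < m, π i ∈ S) {ρ : ℕ → K}
    (hρ : Set.InjOn ρ (Set.Iio m)) {f : V → K} (hf : ∀ v ∈ U, f v = ρ (γ v)) :
    ∃ g, G.RecolorsTo U S (2 * U.card) f g ∧ ∀ v ∈ U, g v = π (γ v) := by
  obtain ⟨g, hg, hgπ⟩ := exists_recolorsTo_rename (G := G) hS hγ hproper hπ hπS ρ hρ f hf
  refine ⟨g, hg.mono ?_, hgπ⟩
  rw [mul_comm, ← smul_eq_mul]
  exact Finset.sum_le_card_nsmul _ _ _ fun v _ => moveCost_le_two _ _ _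

end Rename

/-! ### Recolouring to a canonical colouring -/

/-- The colouring `γ` of `U` with `m` colours is optimal, and with more than `m` colours available,
every renaming of it is reached from every proper colouring by `2 * m * U.card` recolourings. -/
structure IsHub [DecidableEq V] (K : Type*) (G : SimpleGraph V) (U : Finset V) (m : ℕ)
    (γ : V → ℕ) : Prop where
  lt : ∀ v ∈ U, γ v < m
  proper : ∀ v ∈ U, ∀ w ∈ U, G.Adj v w → γ v ≠ γ w
  clique : ∃ Q ⊆ U, G.IsClique (Q : Set V) ∧ Q.card = m
  reach : ∀ (S : Finset K), m < S.card → ∀ π : ℕ → K, Set.InjOn π (Set.Iio m) →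
    (∀ i < m, π i ∈ S) → ∀ f : V → K, (∀ v ∈ U, f v ∈ S) →
    (∀ v ∈ U, ∀ w ∈ U, G.Adj v w → f v ≠ f w) →
    ∃ g, G.RecolorsTo U S (2 * m * U.card) f g ∧ ∀ v ∈ U, g v = π (γ v)

section Hub

variable [DecidableEq V] {A B : Finset V} {m n : ℕ} {γ δ : V → ℕ}

theorem isHub_empty : G.IsHub K ∅ 0 0 :=
  ⟨by simp, by simp, ⟨∅, by simp⟩, fun _ _ _ _ _ f _ _ => ⟨f, .refl _ _, by simp⟩⟩

theorem isHub_singleton (v : V) : G.IsHub K {v} 1 0 := by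
  refine ⟨by simp, by simp, ⟨{v}, by simp⟩, fun S _ π _ hπ f _ _ => ⟨Function.update f v (π 0),
    ((RecolorsTo.refl f 1).step (by simp) (hπ 0 one_pos) (by simp)), by simp⟩⟩

theorem IsHub.union (hA : G.IsHub K A m γ) (hB : G.IsHub K B n δ) (hAB : Disjoint A B)
    (hno : ∀ a ∈ A, ∀ b ∈ B, ¬ G.Adj a b) :
    G.IsHub K (A ∪ B) (max m n) (fun v => if v ∈ A then γ v else δ v) := by
  have hBA : ∀ v ∈ B, v ∉ A := fun v hv => Finset.disjoint_right.1 hAB hv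
  refine ⟨?_, ?_, ?_, ?_⟩
  · intro v hv
    by_cases hvA : v ∈ A
    · simp [hvA, hA.lt v hvA]
    · simp [hvA, hB.lt v ((Finset.mem_union.1 hv).resolve_left hvA)]
  · intro v hv w hw hadj
    rcases Finset.mem_union.1 hv with hv | hv <;> rcases Finset.mem_union.1 hw with hw | hw
    · simpa [hv, hw] using hA.proper v hv w hw hadj
    · exact absurd hadj (hno v hv w hw)
    · exact absurd hadj.symm (hno w hw v hv)
    · simpa [hBA v hv, hBA w hw] using hB.proper v hv w hw hadj
  · rcases le_total m n with hmn | hmn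
    · obtain ⟨Q, hQ, hQc, hQn⟩ := hB.clique
      exact ⟨Q, hQ.trans Finset.subset_union_right, hQc, by rw [max_eq_right hmn, hQn]⟩
    · obtain ⟨Q, hQ, hQc, hQn⟩ := hA.clique
      exact ⟨Q, hQ.trans Finset.subset_union_left, hQc, by rw [max_eq_left hmn, hQn]⟩
  · intro S hS π hπ hπS f hfS hf
    have hm : m ≤ max m n := le_max_left _ _
    have hn : n ≤ max m n := le_max_right _ _
    have hfA : ∀ v ∈ A, f v ∈ S := fun v hv => hfS v (Finset.mem_union_left _ hv)
    obtain ⟨g, hfg, hg⟩ := hA.reach S (by omega) π (hπ.mono (Set.Iio_subset_Iio hm))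
      (fun i hi => hπS i (by omega)) f hfA
      (fun v hv w hw => hf v (Finset.mem_union_left _ hv) w (Finset.mem_union_left _ hw))
    have hgB : ∀ v ∈ B, g v = f v := fun v hv => hfg.eq_of_notMem (hBA v hv)
    obtain ⟨h, hgh, hh⟩ := hB.reach S (by omega) π (hπ.mono (Set.Iio_subset_Iio hn))
      (fun i hi => hπS i (by omega)) g
      (fun v hv => hgB v hv ▸ hfS v (Finset.mem_union_right _ hv))
      (fun v hv w hw => by
        rw [hgB v hv, hgB w hw]
        exact hf v (Finset.mem_union_right _ hv) w (Finset.mem_union_right _ hw))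
    refine ⟨h, ((hfg.lift Finset.subset_union_left subset_rfl ?_).trans
      (hgh.lift Finset.subset_union_right subset_rfl ?_)).mono ?_, ?_⟩
    · intro v hv w hw hwA hadj
      exact absurd hadj (hno v hv w ((Finset.mem_union.1 hw).resolve_left hwA))
    · intro v hv w hw hwB hadj
      exact absurd hadj.symm (hno w ((Finset.mem_union.1 hw).resolve_right hwB) v hv)
    · rw [Finset.card_union_of_disjoint hAB, mul_add]
      gcongr
    · intro v hv
      by_cases hvA : v ∈ A
      · rw [if_pos hvA, hgh.eq_of_notMem (Finset.disjoint_left.1 hAB hvA), hg v hvA]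
      · rw [if_neg hvA, hh v ((Finset.mem_union.1 hv).resolve_left hvA)]

theorem exists_injOn_of_le_card {S : Finset K} (h : m ≤ S.card) (hm : 0 < m) :
    ∃ π : ℕ → K, Set.InjOn π (Set.Iio m) ∧ ∀ i < m, π i ∈ S := by
  classical
  let e := S.equivFin.symm
  have hS : 0 < S.card := by omega
  refine ⟨fun i => e ⟨i % S.card, Nat.mod_lt _ hS⟩, fun a ha b hb hab => ?_, fun i _ => (e _).2⟩
  have := e.injective (Subtype.ext hab)
  simpa [Nat.mod_eq_of_lt (lt_of_lt_of_le ha h), Nat.mod_eq_of_lt (lt_of_lt_of_le hb h)] using this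

/-- One of the two sides of a join can be recoloured first, then the other one. -/
theorem IsHub.exists_recolorsTo_join [DecidableEq K] (hA : G.IsHub K A m γ) (hB : G.IsHub K B n δ)
    (hm : 0 < m) (hn : 0 < n) (hAB : Disjoint A B)
    {S : Finset K} (hS : m + n < S.card) {f : V → K} (hfS : ∀ v ∈ A ∪ B, f v ∈ S)
    (hf : ∀ v ∈ A ∪ B, ∀ w ∈ A ∪ B, G.Adj v w → f v ≠ f w)
    (hAf : m < (S \ B.image f).card) (hall : ∀ a ∈ A, ∀ b ∈ B, G.Adj a b) :
    ∃ g, ∃ π σ : ℕ → K, G.RecolorsTo (A ∪ B) S (2 * m * A.card + 2 * n * B.card) f g ∧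
      Set.InjOn π (Set.Iio m) ∧ Set.InjOn σ (Set.Iio n) ∧ (∀ i < m, ∀ j < n, π i ≠ σ j) ∧
      (∀ v ∈ A, g v = π (γ v)) ∧ ∀ v ∈ B, g v = σ (δ v) := by
  have hBA : ∀ v ∈ B, v ∉ A := fun v hv => Finset.disjoint_right.1 hAB hv
  obtain ⟨π, hπ, hπS⟩ := exists_injOn_of_le_card hAf.le hm
  have hπS' : (Finset.range m).image π ⊆ S := by
    intro c hc
    obtain ⟨i, hi, rfl⟩ := Finset.mem_image.1 hc
    exact (Finset.mem_sdiff.1 (hπS i (Finset.mem_range.1 hi))).1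
  have hπcard : ((Finset.range m).image π).card = m := by
    rw [Finset.card_image_of_injOn (by simpa using hπ), Finset.card_range]
  -- Once `A` uses only the `m` colours of `π`, more than `n` colours are left for `B`.
  have hcard : n < (S \ (Finset.range m).image π).card := by
    rw [Finset.card_sdiff_of_subset hπS', hπcard]; omega
  obtain ⟨σ, hσ, hσS⟩ := exists_injOn_of_le_card hcard.le hn
  have hfA : ∀ v ∈ A, f v ∈ S \ B.image f := by
    intro v hv
    refine Finset.mem_sdiff.2 ⟨hfS v (Finset.mem_union_left _ hv), fun hc => ?_⟩
    obtain ⟨w, hw, hwv⟩ := Finset.mem_image.1 hc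
    exact hf v (Finset.mem_union_left _ hv) w (Finset.mem_union_right _ hw)
      (hall v hv w hw) hwv.symm
  obtain ⟨g, hfg, hg⟩ := hA.reach _ hAf π hπ hπS f hfA
    (fun v hv w hw => hf v (Finset.mem_union_left _ hv) w (Finset.mem_union_left _ hw))
  have hgB : ∀ v ∈ B, g v = f v := fun v hv => hfg.eq_of_notMem (hBA v hv)
  obtain ⟨h, hgh, hh⟩ := hB.reach _ hcard σ hσ hσS g
    (fun v hv => by
      rw [hgB v hv]
      refine Finset.mem_sdiff.2 ⟨hfS v (Finset.mem_union_right _ hv), fun hc => ?_⟩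
      obtain ⟨i, hi, hiv⟩ := Finset.mem_image.1 hc
      exact (Finset.mem_sdiff.1 (hπS i (Finset.mem_range.1 hi))).2
        (hiv ▸ Finset.mem_image_of_mem f hv))
    (fun v hv w hw => by
      rw [hgB v hv, hgB w hw]
      exact hf v (Finset.mem_union_right _ hv) w (Finset.mem_union_right _ hw))
  refine ⟨h, π, σ, (hfg.lift Finset.subset_union_left Finset.sdiff_subset ?_).trans
    (hgh.lift Finset.subset_union_right Finset.sdiff_subset ?_), hπ, hσ, ?_, ?_, hh⟩
  · intro v hv w hw hwA _ hc
    exact (Finset.mem_sdiff.1 hc).2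
      (Finset.mem_image_of_mem f ((Finset.mem_union.1 hw).resolve_left hwA))
  · intro v hv w hw hwB _ hc
    have hwA := (Finset.mem_union.1 hw).resolve_right hwB
    rw [hg w hwA] at hc
    exact (Finset.mem_sdiff.1 hc).2
      (Finset.mem_image_of_mem π (Finset.mem_range.2 (hA.lt w hwA)))
  · intro i hi j hj hij
    exact (Finset.mem_sdiff.1 (hσS j hj)).2
      (hij ▸ Finset.mem_image_of_mem π (Finset.mem_range.2 hi))
  · intro v hv
    rw [hgh.eq_of_notMem (Finset.disjoint_left.1 hAB hv), hg v hv]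

theorem IsHub.join (hA : G.IsHub K A m γ) (hB : G.IsHub K B n δ) (hm : 0 < m) (hn : 0 < n)
    (hAB : Disjoint A B) (hall : ∀ a ∈ A, ∀ b ∈ B, G.Adj a b) :
    G.IsHub K (A ∪ B) (m + n) (fun v => if v ∈ A then γ v else m + δ v) := by
  classical
  have hBA : ∀ v ∈ B, v ∉ A := fun v hv => Finset.disjoint_right.1 hAB hv
  have hlt : ∀ v ∈ A ∪ B, (if v ∈ A then γ v else m + δ v) < m + n := by
    intro v hv
    by_cases hvA : v ∈ A
    · simpa [hvA] using (hA.lt v hvA).trans_le (Nat.le_add_right _ _)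
    · simp [hvA, hB.lt v ((Finset.mem_union.1 hv).resolve_left hvA)]
  have hproper : ∀ v ∈ A ∪ B, ∀ w ∈ A ∪ B, G.Adj v w →
      (if v ∈ A then γ v else m + δ v) ≠ if w ∈ A then γ w else m + δ w := by
    intro v hv w hw hadj
    rcases Finset.mem_union.1 hv with hv | hv <;> rcases Finset.mem_union.1 hw with hw | hw
    · simpa [hv, hw] using hA.proper v hv w hw hadj
    · have := hA.lt v hv
      rw [if_pos hv, if_neg (hBA w hw)]; omega
    · have := hA.lt w hw
      rw [if_pos hw, if_neg (hBA v hv)]; omega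
    · simpa [hBA v hv, hBA w hw] using hB.proper v hv w hw hadj
  refine ⟨hlt, hproper, ?_, ?_⟩
  · obtain ⟨P, hP, hPc, hPm⟩ := hA.clique
    obtain ⟨Q, hQ, hQc, hQn⟩ := hB.clique
    refine ⟨P ∪ Q, Finset.union_subset_union hP hQ, ?_, ?_⟩
    · intro v hv w hw hne
      rw [Finset.mem_coe, Finset.mem_union] at hv hw
      rcases hv with hv | hv <;> rcases hw with hw | hw
      · exact hPc hv hw hne
      · exact hall v (hP hv) w (hQ hw)
      · exact (hall w (hP hw) v (hQ hv)).symm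
      · exact hQc hv hw hne
    · rw [Finset.card_union_of_disjoint (hAB.mono hP hQ), hPm, hQn]
  · intro S hS π hπ hπS f hfS hf
    obtain ⟨g, ρ, σ, hfg, hρ, hσ, hρσ, hgA, hgB⟩ :
        ∃ g, ∃ ρ σ : ℕ → K, G.RecolorsTo (A ∪ B) S (2 * m * A.card + 2 * n * B.card) f g ∧
        Set.InjOn ρ (Set.Iio m) ∧ Set.InjOn σ (Set.Iio n) ∧ (∀ i < m, ∀ j < n, ρ i ≠ σ j) ∧
        (∀ v ∈ A, g v = ρ (γ v)) ∧ ∀ v ∈ B, g v = σ (δ v) := by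
      -- If `A` has no spare colour, `B.image f` has more than `n` colours, all missing from `A`, so
      -- the roles are exchanged.
      rcases lt_or_ge m (S \ B.image f).card with hlt | hge
      · exact hA.exists_recolorsTo_join hB hm hn hAB hS hfS hf hlt hall
      · have hdisj : Disjoint (A.image f) (B.image f) := by
          rw [Finset.disjoint_left]
          intro c hc hc'
          obtain ⟨v, hv, rfl⟩ := Finset.mem_image.1 hc
          obtain ⟨w, hw, hwv⟩ := Finset.mem_image.1 hc'
          exact hf v (Finset.mem_union_left _ hv) w (Finset.mem_union_right _ hw)
            (hall v hv w hw) hwv.symm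
        have hsub : B.image f ⊆ S \ A.image f := by
          intro c hc
          refine Finset.mem_sdiff.2 ⟨?_, Finset.disjoint_right.1 hdisj hc⟩
          obtain ⟨w, hw, rfl⟩ := Finset.mem_image.1 hc
          exact hfS w (Finset.mem_union_right _ hw)
        have h1 := Finset.card_le_card hsub
        have h2 := Finset.card_sdiff_add_card S (B.image f)
        have h3 := Finset.card_le_card (Finset.subset_union_left (s₁ := S) (s₂ := B.image f))
        obtain ⟨g, σ, ρ, h, hσ, hρ, hne, hgB, hgA⟩ :=
          hB.exists_recolorsTo_join hA hn hm hAB.symm (S := S) (f := f) (by omega)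
            (by rwa [Finset.union_comm]) (by rwa [Finset.union_comm]) (by omega)
            (fun b hb a ha => (hall a ha b hb).symm)
        rw [Finset.union_comm, add_comm] at h
        exact ⟨g, ρ, σ, h, hρ, hσ, fun i hi j hj => (hne j hj i hi).symm, hgA, hgB⟩
    obtain ⟨h, hgh, hh⟩ := exists_recolorsTo_rename_le (G := G) hS hlt hproper hπ hπS
      (ρ := fun i => if i < m then ρ i else σ (i - m)) (f := g)
      (by
        intro a ha b hb hab
        rw [Set.mem_Iio] at ha hb
        by_cases ham : a < m <;> by_cases hbm : b < m <;>
          simp only [ham, hbm, if_true, if_false] at hab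
        · exact hρ ham hbm hab
        · exact absurd hab (hρσ a ham _ (by omega))
        · exact absurd hab.symm (hρσ b hbm _ (by omega))
        · have := hσ (Set.mem_Iio.2 (by omega)) (Set.mem_Iio.2 (by omega)) hab
          omega)
      (by
        intro v hv
        by_cases hvA : v ∈ A
        · simp [hvA, hA.lt v hvA, hgA v hvA]
        · simp [hvA, hgB v ((Finset.mem_union.1 hv).resolve_left hvA)])
    refine ⟨h, (hfg.trans hgh).mono ?_, hh⟩
    rw [Finset.card_union_of_disjoint hAB]
    -- Since `m, n ≥ 1`, the cross terms `2 * n * A.card` and `2 * m * B.card` absorb the renaming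
    -- cost.
    nlinarith [Nat.mul_le_mul_right A.card hn, Nat.mul_le_mul_right B.card hm]

end Hub

theorem PathFourFree.exists_isHub [DecidableEq V] (K : Type*) (h : G.PathFourFree) (U : Finset V) :
    ∃ m γ, G.IsHub K U m γ := by
  induction U using Finset.strongInduction with
  | H U ih =>
  rcases U.eq_empty_or_nonempty with rfl | hne
  · exact ⟨_, _, isHub_empty⟩
  by_cases hone : U.card = 1
  · obtain ⟨v, rfl⟩ := Finset.card_eq_one.1 hone
    exact ⟨_, _, isHub_singleton v⟩
  have hpos := hne.card_pos
  have hss : ∀ A B : Finset V, A.Nonempty → B.Nonempty → Disjoint A B → A ∪ B = U →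
      A ⊂ U ∧ B ⊂ U := by
    rintro A B ⟨a, ha⟩ ⟨b, hb⟩ hAB rfl
    exact ⟨⟨Finset.subset_union_left, fun h => Finset.disjoint_right.1 hAB hb
        (h (Finset.mem_union_right _ hb))⟩,
      ⟨Finset.subset_union_right, fun h => Finset.disjoint_left.1 hAB ha
        (h (Finset.mem_union_left _ ha))⟩⟩
  rcases h.splitsOn U (by omega) with hs | hs <;>
    obtain ⟨A, B, hA, hB, hAB, hU, hno⟩ := hs <;>
    obtain ⟨hAU, hBU⟩ := hss A B hA hB hAB hU <;>
    obtain ⟨m, γ, hγ⟩ := ih A hAU <;>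
    obtain ⟨n, δ, hδ⟩ := ih B hBU <;>
    rw [← hU]
  · exact ⟨_, _, hγ.union hδ hAB hno⟩
  · refine ⟨_, _, hγ.join hδ ?_ ?_ hAB fun a ha b hb => ?_⟩
    · obtain ⟨a, ha⟩ := hA
      exact Nat.zero_lt_of_lt (hγ.lt a ha)
    · obtain ⟨b, hb⟩ := hB
      exact Nat.zero_lt_of_lt (hδ.lt b hb)
    · have := hno a ha b hb
      rw [compl_adj, not_and, not_not] at this
      exact this fun hab => Finset.disjoint_left.1 hAB ha (hab ▸ hb)

/-! ### Distances in the recolouring graph. -/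

theorem RecolorsTo.edist_le [DecidableEq V] [Fintype V] {k n : ℕ} {S : Finset (Fin k)}
    {f g : V → Fin k} (h : G.RecolorsTo Finset.univ S n f g) (α : G.Coloring (Fin k))
    (hα : ⇑α = f) : ∃ β : G.Coloring (Fin k), ⇑β = g ∧ (G.recoloringGraph k).edist α β ≤ n := by
  induction h with
  | refl f n => exact ⟨α, hα, by simp⟩
  | @step n f g v c _ _ _ hfree ih =>
    obtain ⟨β, rfl, hβ⟩ := ih hα
    let β' : G.Coloring (Fin k) := Coloring.mk (Function.update β v c) (by
      intro a b hab
      by_cases hav : a = v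
      · subst hav
        rw [Function.update_self, Function.update_of_ne hab.ne']
        exact (hfree b (Finset.mem_univ _) hab).symm
      · by_cases hbv : b = v
        · subst hbv
          rw [Function.update_self, Function.update_of_ne hav]
          exact hfree a (Finset.mem_univ _) hab.symm
        · rw [Function.update_of_ne hav, Function.update_of_ne hbv]
          exact β.valid hab)
    refine ⟨β', rfl, (SimpleGraph.edist_triangle (v := β)).trans ?_⟩
    push_cast
    refine add_le_add hβ ?_
    -- A recolouring may repeat the old colour; it is then no edge, but costs nothing.
    by_cases hc : β v = c
    · have : β' = β := by
        ext w
        change (Function.update β v c w : Fin k).val = _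
        rw [← hc, Function.update_eq_self]
      rw [this, edist_self]
      exact zero_le_one
    · refine le_of_eq (edist_eq_one_iff_adj.2 ⟨v, ?_, fun w hw => ?_⟩)
      · change β v ≠ Function.update β v c v
        rwa [Function.update_self]
      · by_contra hwv
        refine hw ?_
        change β w = Function.update β v c w
        rw [Function.update_of_ne hwv]

/-- Any two colourings of a cograph with a spare colour are close in the recolouring graph. -/
theorem IsCograph.edist_le [Fintype V] (h : G.IsCograph) {k : ℕ}
    (hk : G.chromaticNumber + 1 ≤ (k : ℕ∞)) (α β : G.Coloring (Fin k)) :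
    (G.recoloringGraph k).edist α β ≤
      ((4 : ℕ) : ℕ∞) * G.chromaticNumber * (Fintype.card V : ℕ∞) := by
  classical
  obtain ⟨m, γ, hγ⟩ := h.pathFourFree.exists_isHub (Fin k) Finset.univ
  obtain ⟨Q, -, hQ, hQm⟩ := hγ.clique
  have hm : (m : ℕ∞) ≤ G.chromaticNumber := hQm ▸ hQ.card_le_chromaticNumber
  have hmk : m < k := by
    have : ((m + 1 : ℕ) : ℕ∞) ≤ k := by
      push_cast
      exact (add_le_add_left hm 1).trans hk
    exact_mod_cast this
  let π : ℕ → Fin k := fun i => ⟨i % k, Nat.mod_lt _ (by omega)⟩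
  have hπ : Set.InjOn π (Set.Iio m) := by
    intro a ha b hb hab
    rw [Set.mem_Iio] at ha hb
    simpa [π, Nat.mod_eq_of_lt (ha.trans hmk), Nat.mod_eq_of_lt (hb.trans hmk)] using hab
  have reach : ∀ α : G.Coloring (Fin k), ∃ η : G.Coloring (Fin k), (∀ v, η v = π (γ v)) ∧
      (G.recoloringGraph k).edist α η ≤ (2 * m * Fintype.card V : ℕ) := by
    intro α
    obtain ⟨g, hg, hgπ⟩ := hγ.reach Finset.univ (by simpa using hmk) π hπ (by simp) α (by simp)
      (fun v _ w _ hadj => α.valid hadj)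
    obtain ⟨η, rfl, hη⟩ := hg.edist_le α rfl
    exact ⟨η, fun v => hgπ v (Finset.mem_univ v), hη⟩
  obtain ⟨η, hη, hαη⟩ := reach α
  obtain ⟨θ, hθ, hβθ⟩ := reach β
  obtain rfl : η = θ := by
    ext v
    rw [hη, hθ]
  rw [edist_comm] at hβθ
  calc (G.recoloringGraph k).edist α β
      ≤ (2 * m * Fintype.card V : ℕ) + (2 * m * Fintype.card V : ℕ) :=
        SimpleGraph.edist_triangle.trans (add_le_add hαη hβθ)
    _ = ((4 : ℕ) : ℕ∞) * m * Fintype.card V := by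
        norm_cast
        ring
    _ ≤ _ := by gcongr

end SimpleGraph

theorem corollary3 :
    ∃ C : ℕ, ∀ (V : Type*) [Fintype V] (G : SimpleGraph V) (k : ℕ),
      G.IsCograph → G.chromaticNumber + 1 ≤ (k : ℕ∞) →
        G.IsMixing k ∧
          G.recoloringDiam k ≤ (C : ℕ∞) * G.chromaticNumber * (Fintype.card V : ℕ∞) := by
  refine ⟨4, fun V _ G k hG hk => ⟨?_,
    SimpleGraph.ediam_le_of_edist_le fun α β => hG.edist_le hk α β⟩⟩
  have hfin : G.chromaticNumber ≠ ⊤ := fun h => by simp [h] at hk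
  obtain ⟨α⟩ : Nonempty (G.Coloring (Fin k)) :=
    SimpleGraph.chromaticNumber_le_iff_colorable.1 (le_self_add.trans hk)
  have : Nonempty (G.Coloring (Fin k)) := ⟨α⟩
  -- Mixing follows from the distance bound, which is finite because `χ` is.
  refine SimpleGraph.Connected.mk fun α β => SimpleGraph.reachable_of_edist_ne_top fun htop => ?_
  have hle := hG.edist_le hk α β
  rw [htop, top_le_iff] at hle
  exact WithTop.mul_ne_top (WithTop.mul_ne_top (ENat.natCast_ne_top _) hfin)
    (ENat.natCast_ne_top _) hle
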